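/- **Proposition (area conservation and energy dissipation for the weak formulation of anisotropic surface diffusion).** Let $\mathbb T=\mathbb R/\mathbb Z=[0,1]$, and let $(a,b)^\perp=(b,-a)$ denote the clockwise rotation by $\pi/2$. Let $\gamma:\mathbb S^1\to\mathbb R$ be a surface energy density whose one-homogeneous extension $\gamma(\boldsymbol p)=|\boldsymbol p|\,\gamma(\boldsymbol p/|\boldsymbol p|)$, $\gamma(\boldsymbol 0)=0$, is $C^1$ on $\mathbb R^2\setminus\{\boldsymbol 0\}$, put $\boldsymbol\xi(\boldsymbol n)=\nabla\gamma(\boldsymbol p)|_{\boldsymbol p=\boldsymbol n}$, let $k:\mathbb S^1\to[0,\infty)$ be any function, and define the surface energy matrix $$\boldsymbol G_k(\boldsymbol n)=\gamma(\boldsymbol n)I_2-\boldsymbol n\boldsymbol\xi^T+\boldsymbol\xi\boldsymbol n^T+k(\boldsymbol n)\boldsymbol n\boldsymbol n^T,\qquad \boldsymbol n\in\mathbb S^1 .$$ For a closed curve $\Gamma(t)$ parametrized by $\boldsymbol X(\cdot,t)=(x(\cdot,t),y(\cdot,t))^T:\mathbb T\to\mathbb R^2$ write $\partial_\rho s=|\partial_\rho\boldsymbol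 X|$, $\partial_s=(\partial_\rho s)^{-1}\partial_\rho$, $\boldsymbol n=-(\partial_s\boldsymbol X)^\perp$ (the outward unit normal when the curve is simple and traversed clockwise), and $(u,v)_{\Gamma(t)}=\int_{\mathbb T}u\cdot v\,\partial_\rho s\,d\rho$. Let $\boldsymbol X(\cdot,t)\in[H^1(\mathbb T)]^2$ and $\mu(\cdot,t)\in H^1(\mathbb T)$, $t\ge 0$, be a solution of the variational formulation of anisotropic surface diffusion, that is: * $\boldsymbol X\in C([0,\infty);[H^1(\mathbb T)]^2)\cap W^{1,1}_{loc}((0,\infty);[H^1(\mathbb T)]^2)$; * the parametrization is regular: there is a constant $C>1$ with $\frac1C\le\partial_\rho s(\rho,t)\le C$ for all $t\ge0$ and almost every $\rho\in\mathbb T$; * for almost every $t>0$, $$\bigl(\boldsymbol n\cdot\partial_t\boldsymbol X,\varphi\bigr)_{\Gamma(t)}+\bigl(\partial_s\mu,\partial_s\varphi\bigr)_{\Gamma(t)}=0\qquad\forall\varphi\in H^1(\mathbb T),$$ $$\bigl(\mu\boldsymbol n,\boldsymbol\omega\bigr)_{\Gamma(t)}-\bigl(\boldsymbol G_k(\boldsymbol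 n)\partial_s\boldsymbol X,\partial_s\boldsymbol\omega\bigr)_{\Gamma(t)}=0\qquad\forall\boldsymbol\omega\in[H^1(\mathbb T)]^2 .$$ Let $$A(t)=\int_{\mathbb T}y(\rho,t)\,\partial_\rho x(\rho,t)\,d\rho,\qquad W(t)=\int_{\Gamma(t)}\gamma(\boldsymbol n)\,ds=\int_{\mathbb T}\gamma(\boldsymbol n)\,\partial_\rho s\,d\rho$$ be the enclosed area and the interfacial energy. Then $$A(t)=A(0)\quad\text{for all }t\ge0,\qquad W(t)\le W(t_1)\le W(0)\quad\text{for all }t\ge t_1\ge0 .$$ -/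

import Mathlib

namespace SurfaceDiffusion

open MeasureTheory Set
open scoped ContDiff

/-- The Euclidean plane `ℝ²`. -/
abbrev Plane : Type := EuclideanSpace ℝ (Fin 2)

/-- Lebesgue measure on the periodic interval `𝕋 = ℝ/ℤ = [0, 1]`. -/
noncomputable abbrev torusMeasure : Measure ℝ := volume.restrict (Ioc (0 : ℝ) 1)

/-- The Lebesgue space `L²(𝕋; E)`. -/
abbrev L2 (E : Type) [NormedAddCommGroup E] : Type := Lp E 2 torusMeasure

instance : IsProbabilityMeasure torusMeasure := ⟨by simp⟩

section Sobolev

variable {E : Type} [NormedAddCommGroup E] [NormedSpace ℝ E]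

/-- `g` is the weak derivative of `u` on the torus `𝕋`: integration by parts holds against all
smooth `1`-periodic test functions. -/
def IsWeakDeriv (u g : ℝ → E) : Prop :=
  ∀ φ : ℝ → ℝ, ContDiff ℝ ∞ φ → Function.Periodic φ 1 →
    ∫ ρ, deriv φ ρ • u ρ ∂torusMeasure = -∫ ρ, φ ρ • g ρ ∂torusMeasure

lemma exists_bound_torus {ψ : ℝ → ℝ} (hψ : Continuous ψ) :
    ∃ C : ℝ, ∀ᵐ ρ ∂torusMeasure, ‖ψ ρ‖ ≤ C := by
  obtain ⟨C, hC⟩ := (isCompact_Icc (a := (0 : ℝ)) (b := 1)).exists_bound_of_continuousOn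
    hψ.continuousOn
  refine ⟨C, ?_⟩
  filter_upwards [ae_restrict_mem measurableSet_Ioc] with ρ hρ
  exact hC ρ ⟨hρ.1.le, hρ.2⟩

lemma integrable_smul_L2 {ψ : ℝ → ℝ} (hψ : Continuous ψ) (u : L2 E) :
    Integrable (fun ρ => ψ ρ • u ρ) torusMeasure := by
  obtain ⟨C, hC⟩ := exists_bound_torus hψ
  exact ((Lp.memLp u).integrable one_le_two).bdd_smul C hψ.aestronglyMeasurable hC

/-- Pairing with a continuous function, as a continuous linear functional on `L²(𝕋; E)`. -/
noncomputable def pairing (ψ : ℝ → ℝ) (hψ : Continuous ψ) : L2 E →L[ℝ] E :=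
  LinearMap.mkContinuousOfExistsBound
    { toFun := fun u => ∫ ρ, ψ ρ • u ρ ∂torusMeasure
      map_add' := by
        intro u v
        rw [← integral_add (integrable_smul_L2 hψ u) (integrable_smul_L2 hψ v)]
        refine integral_congr_ae ?_
        filter_upwards [Lp.coeFn_add u v] with ρ h
        rw [h, Pi.add_apply, smul_add]
      map_smul' := by
        intro c u
        rw [RingHom.id_apply, ← integral_smul]
        refine integral_congr_ae ?_
        filter_upwards [Lp.coeFn_smul c u] with ρ h
        rw [h, Pi.smul_apply, smul_comm] }
    (by
      obtain ⟨C, hC⟩ := exists_bound_torus hψ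
      refine ⟨C, fun u => ?_⟩
      have hC0 : 0 ≤ C := by
        obtain ⟨ρ, h⟩ := hC.exists
        exact (norm_nonneg _).trans h
      have hi : Integrable (fun ρ => u ρ) torusMeasure := (Lp.memLp u).integrable one_le_two
      calc ‖∫ ρ, ψ ρ • u ρ ∂torusMeasure‖ ≤ ∫ ρ, C * ‖u ρ‖ ∂torusMeasure := by
            refine norm_integral_le_of_norm_le (hi.norm.const_mul C) ?_
            filter_upwards [hC] with ρ h
            rw [norm_smul]
            gcongr
        _ = C * ∫ ρ, ‖u ρ‖ ∂torusMeasure := integral_const_mul _ _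
        _ ≤ C * ‖u‖ := by
            refine mul_le_mul_of_nonneg_left ?_ hC0
            rw [integral_norm_eq_lintegral_enorm hi.aestronglyMeasurable,
              ← eLpNorm_one_eq_lintegral_enorm, Lp.norm_def]
            exact ENNReal.toReal_mono (Lp.eLpNorm_ne_top u)
              (eLpNorm_le_eLpNorm_of_exponent_le one_le_two hi.aestronglyMeasurable))

lemma isWeakDeriv_iff (u g : L2 E) : IsWeakDeriv u g ↔
    ∀ (φ : ℝ → ℝ) (h : ContDiff ℝ ∞ φ), Function.Periodic φ 1 →
      pairing (deriv φ) (h.continuous_deriv (by simp)) u + pairing φ h.continuous g = 0 := by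
  simp only [add_eq_zero_iff_eq_neg]
  rfl

variable (E) in
/-- The Sobolev space `H¹(𝕋; E)`, realised as the space of pairs `(u, ∂_ρ u)` in `L² × L²` such
that the second entry is the weak derivative of the first one, with the usual norm
`‖u‖² = ‖u‖²_{L²} + ‖∂_ρ u‖²_{L²}`. -/
noncomputable def H1 : Submodule ℝ (WithLp 2 (L2 E × L2 E)) where
  carrier := {p | IsWeakDeriv (p.fst : ℝ → E) (p.snd : ℝ → E)}
  zero_mem' := by
    refine (isWeakDeriv_iff _ _).2 fun φ h _ => ?_
    simp
  add_mem' := by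
    intro p q hp hq
    refine (isWeakDeriv_iff _ _).2 fun φ h hφ => ?_
    have h1 := (isWeakDeriv_iff _ _).1 hp φ h hφ
    have h2 := (isWeakDeriv_iff _ _).1 hq φ h hφ
    simp only [WithLp.add_fst, WithLp.add_snd, map_add]
    rw [add_add_add_comm, h1, h2, add_zero]
  smul_mem' := by
    intro c p hp
    refine (isWeakDeriv_iff _ _).2 fun φ h hφ => ?_
    have h1 := (isWeakDeriv_iff _ _).1 hp φ h hφ
    simp only [WithLp.smul_fst, WithLp.smul_snd, map_smul]
    rw [← smul_add, h1, smul_zero]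

lemma isClosed_H1 : IsClosed (H1 E : Set (WithLp 2 (L2 E × L2 E))) := by
  have : (H1 E : Set (WithLp 2 (L2 E × L2 E))) =
      ⋂ (φ : ℝ → ℝ) (h : ContDiff ℝ ∞ φ) (_ : Function.Periodic φ 1),
        {p | pairing (deriv φ) (h.continuous_deriv (by simp)) p.fst
          + pairing φ h.continuous p.snd = 0} := by
    ext p
    simp only [mem_iInter, mem_ofPred_eq]
    exact isWeakDeriv_iff _ _
  rw [this]
  refine isClosed_iInter fun φ => isClosed_iInter fun h => isClosed_iInter fun _ =>
    isClosed_eq ?_ continuous_const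
  have h1 : Continuous fun p : WithLp 2 (L2 E × L2 E) => p.fst :=
    (WithLp.fstL 2 ℝ (L2 E) (L2 E)).continuous
  have h2 : Continuous fun p : WithLp 2 (L2 E × L2 E) => p.snd :=
    (WithLp.sndL 2 ℝ (L2 E) (L2 E)).continuous
  fun_prop

instance [CompleteSpace E] : CompleteSpace (H1 E) :=
  (isClosed_H1 (E := E)).completeSpace_coe

/-- The underlying (almost everywhere defined) function `u` of an element of `H¹(𝕋; E)`. -/
noncomputable def fn (u : H1 E) : ℝ → E :=
  ((u : WithLp 2 (L2 E × L2 E)).fst : ℝ → E)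

/-- The weak derivative `∂_ρ u` of an element of `H¹(𝕋; E)`. -/
noncomputable def dρ (u : H1 E) : ℝ → E :=
  ((u : WithLp 2 (L2 E × L2 E)).snd : ℝ → E)

end Sobolev

/-- Clockwise rotation by `π/2`: `(a, b)^⊥ = (b, -a)`. -/
noncomputable def perp (v : Plane) : Plane := !₂[v 1, -v 0]

section Anisotropy

/-- The one-homogeneous extension `γ(p) = |p| γ(p/|p|)`, `γ(0) = 0`, of the restriction of `γ` to
the unit circle; it does not depend on the values of `γ` off the unit circle. -/
noncomputable def homExt (γ : Plane → ℝ) (p : Plane) : ℝ := ‖p‖ * γ (‖p‖⁻¹ • p)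

/-- The Cahn-Hoffman vector `ξ(n) = ∇γ(p)|_{p = n}`. -/
noncomputable def cahnHoffman (γ : Plane → ℝ) (n : Plane) : Plane := gradient (homExt γ) n

/-- The surface energy matrix `G_k(n) = γ(n) I₂ - n ξᵀ + ξ nᵀ + k(n) n nᵀ`. -/
noncomputable def surfaceEnergyMatrix (γ k : Plane → ℝ) (n : Plane) :
    Matrix (Fin 2) (Fin 2) ℝ :=
  γ n • (1 : Matrix (Fin 2) (Fin 2) ℝ) - Matrix.vecMulVec n (cahnHoffman γ n)
    + Matrix.vecMulVec (cahnHoffman γ n) n + k n • Matrix.vecMulVec n n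

end Anisotropy

section Curve

variable {E : Type} [NormedAddCommGroup E] [NormedSpace ℝ E]

/-- `∂_ρ s = |∂_ρ X|`, the density of the arc length of the curve `X` with respect to `ρ`. -/
noncomputable def arcDensity (X : H1 Plane) (ρ : ℝ) : ℝ := ‖dρ X ρ‖

/-- The arc-length derivative `∂_s u = ∂_ρ u / ∂_ρ s` along the curve `X`. -/
noncomputable def ds (X : H1 Plane) (u : H1 E) (ρ : ℝ) : E := (arcDensity X ρ)⁻¹ • dρ u ρ

/-- The unit normal `n` of the curve `X`, that is `n = -(∂_s X)^⊥`, so that the unit tangent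
is `τ = ∂_s X = n^⊥`. It is the outward one for a simple closed curve that is traversed
clockwise. -/
noncomputable def normal (X : H1 Plane) (ρ : ℝ) : Plane := -perp (ds X X ρ)

/-- The weighted inner product `(u, v)_Γ = ∫_Γ u · v ds = ∫_𝕋 u · v ∂_ρ s dρ`. -/
noncomputable def curveInner {F : Type} [NormedAddCommGroup F] [InnerProductSpace ℝ F]
    (X : H1 Plane) (u v : ℝ → F) : ℝ :=
  ∫ ρ, inner ℝ (u ρ) (v ρ) * arcDensity X ρ ∂torusMeasure

/-- The enclosed area `A = ∫_𝕋 y ∂_ρ x dρ` of the curve `X = (x, y)`. -/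
noncomputable def area (X : H1 Plane) : ℝ := ∫ ρ, fn X ρ 1 * dρ X ρ 0 ∂torusMeasure

/-- The interfacial energy `W = ∫_Γ γ(n) ds`. -/
noncomputable def energy (γ : Plane → ℝ) (X : H1 Plane) : ℝ :=
  ∫ ρ, γ (normal X ρ) * arcDensity X ρ ∂torusMeasure

end Curve

/-- `V` is the time derivative `∂_t X` on `(0, ∞)` of a curve `X` in a normed space, in the sense of
`W^{1,1}_loc`: it is locally (Bochner) integrable and `X` is a primitive of it. -/
def IsTimeDeriv {F : Type} [NormedAddCommGroup F] [NormedSpace ℝ F] (X V : ℝ → F) : Prop :=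
  ∀ a b : ℝ, 0 < a → a ≤ b →
    IntervalIntegrable V volume a b ∧ X b - X a = ∫ t in a..b, V t

/-- The two equations of the variational formulation at a fixed time, for the curve `X`, its
velocity `V = ∂_t X` and the weighted curvature `μ`. -/
def WeakEquations (γ k : Plane → ℝ) (X V : H1 Plane) (μ : H1 ℝ) : Prop :=
  (∀ φ : H1 ℝ,
    curveInner X (fun ρ => inner ℝ (normal X ρ) (fn V ρ)) (fn φ)
      + curveInner X (ds X μ) (ds X φ) = 0) ∧
  (∀ η : H1 Plane,
    curveInner X (fun ρ => fn μ ρ • normal X ρ) (fn η)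
      - curveInner X
          (fun ρ => Matrix.toEuclideanLin (surfaceEnergyMatrix γ k (normal X ρ)) (ds X X ρ))
          (ds X η) = 0)

/-- `(X, μ)` is a solution on `[0, ∞)` of the variational formulation of anisotropic surface
diffusion: `X(·, t) ∈ [H¹(𝕋)]²` depends continuously on `t ≥ 0` and has a time derivative in
`[H¹(𝕋)]²`, `μ(·, t) ∈ H¹(𝕋)`, the parametrization is regular during the evolution, and the two
equations hold for almost every `t > 0`. -/
structure IsWeakSolution (γ k : Plane → ℝ) (X : ℝ → H1 Plane) (μ : ℝ → H1 ℝ) : Prop where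
  continuousOn : ContinuousOn X (Ici 0)
  regular : ∃ C : ℝ, 1 < C ∧ ∀ t : ℝ, 0 ≤ t → ∀ᵐ ρ ∂torusMeasure,
    1 / C ≤ arcDensity (X t) ρ ∧ arcDensity (X t) ρ ≤ C
  equations : ∃ V : ℝ → H1 Plane, IsTimeDeriv X V ∧
    ∀ᵐ t ∂(volume.restrict (Ioi (0 : ℝ))), WeakEquations γ k (X t) (V t) (μ t)

end SurfaceDiffusion

/-! Both `area` and `energy γ` are locally Lipschitz on H¹ and differentiable in the direction `V =
∂_t X` at regular curves. Since `X` is a primitive of `V`, each composition with `X` is absolutely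
continuous away from `t = 0`, so the sign of its almost everywhere derivative decides monotonicity
(`IsTimeDeriv.functional_le`). Line derivatives suffice, because the Lipschitz bound controls the
error between the curve and its tangent line.

Energy: W is the integral of the one-homogeneous function `homExt γ` at -(∂_ρ X)^⊥. Homogeneity and
C¹ regularity off 0 make that function globally Lipschitz, which permits differentiation under the
integral. With τ = ∂_s X, Euler's identity γ(n) = ξ·n gives G_k(n)τ = ξ^⊥
(`inner_surfaceEnergyMatrix`), so the derivative is (G_k ∂_s X, ∂_s V)_Γ. The equations tested with
μ and V turn it into -(∂_s μ, ∂_s μ)_Γ ≤ 0.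

Area: A is quadratic in X. Integration by parts, obtained here from Parseval's identity, turns its
derivative into (n·V, 1)_Γ, which vanishes by the first equation tested with 1. -/

namespace SurfaceDiffusion

open MeasureTheory Set Filter Topology
open scoped ContDiff NNReal

/-! ### Monotonicity of functionals along absolutely continuous curves -/

section Evolution

variable {H : Type} [NormedAddCommGroup H] [NormedSpace ℝ H]

/-- Chain rule for a locally Lipschitz function which is merely Gateaux differentiable. -/
lemma hasDerivAt_comp_of_hasLineDerivAt {F : H → ℝ} (hF : LocallyLipschitz F) {c : ℝ → H} {v : H}
    {t f' : ℝ} (hc : HasDerivAt c v t) (hF' : HasLineDerivAt ℝ F f' (c t) v) :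
    HasDerivAt (fun s => F (c s)) f' t := by
  obtain ⟨K, U, hU, hK⟩ := hF (c t)
  have hsub : HasDerivAt (fun s : ℝ => s - t) 1 t := (hasDerivAt_id t).sub_const t
  have hline : HasDerivAt (fun s : ℝ => F (c t + (s - t) • v)) f' t := by
    have h : HasDerivAt (fun r : ℝ => F (c t + r • v)) f' (t - t) := by rw [sub_self]; exact hF'
    exact (HasDerivAt.comp (h := fun s : ℝ => s - t) t h hsub).congr_deriv (mul_one _)
  -- The curve and its tangent line differ by o(s - t), and the local Lipschitz bound passes this on
  -- to `F`.
  have hdiff : HasDerivAt (fun s : ℝ => F (c s) - F (c t + (s - t) • v)) 0 t := by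
    rw [hasDerivAt_iff_isLittleO]
    have hlo := hasDerivAt_iff_isLittleO.1 hc
    have h1 : ∀ᶠ s in 𝓝 t, c s ∈ U := hc.continuousAt hU
    have hcont : ContinuousAt (fun s : ℝ => c t + (s - t) • v) t := by fun_prop
    have h2 : ∀ᶠ s in 𝓝 t, c t + (s - t) • v ∈ U := hcont (by simpa using hU)
    refine Asymptotics.IsBigO.trans_isLittleO (Asymptotics.IsBigO.of_bound K ?_) hlo
    filter_upwards [h1, h2] with s hs1 hs2
    have := hK.dist_le_mul _ hs1 _ hs2
    rw [dist_eq_norm, dist_eq_norm] at this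
    simpa [sub_sub] using this
  simpa using HasDerivAt.congr_of_eventuallyEq (hdiff.add hline)
    (Eventually.of_forall fun s => (sub_add_cancel _ _).symm)

lemma absolutelyContinuousOnInterval_of_dist_le {f G : ℝ → ℝ} {a b : ℝ}
    (hG : AbsolutelyContinuousOnInterval G a b)
    (h : ∀ s ∈ uIcc a b, ∀ t ∈ uIcc a b, dist (f s) (f t) ≤ dist (G s) (G t)) :
    AbsolutelyContinuousOnInterval f a b := by
  rw [absolutelyContinuousOnInterval_iff] at hG ⊢
  intro ε hε
  obtain ⟨δ, hδ, H⟩ := hG ε hε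
  refine ⟨δ, hδ, fun E hE hlt => (Finset.sum_le_sum fun i hi => ?_).trans_lt (H E hE hlt)⟩
  exact h _ (hE.1 i hi).1 _ (hE.1 i hi).2

lemma AbsolutelyContinuousOnInterval.le_of_ae_deriv_nonpos {f : ℝ → ℝ} {a b : ℝ} (hab : a ≤ b)
    (hf : AbsolutelyContinuousOnInterval f a b)
    (h : ∀ᵐ t, t ∈ Ioo a b → deriv f t ≤ 0) : f b ≤ f a := by
  rw [← sub_nonpos, ← hf.integral_deriv_eq_sub, intervalIntegral.integral_of_le hab,
    integral_Ioc_eq_integral_Ioo]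
  refine integral_nonpos_of_ae ?_
  rwa [EventuallyLE, ae_restrict_iff' measurableSet_Ioo]

/-- A locally Lipschitz functional whose line derivative along the velocity is nonpositive at almost
every time does not increase along the curve. -/
lemma IsTimeDeriv.functional_le [CompleteSpace H] {F : H → ℝ} (hF : LocallyLipschitz F)
    {X V : ℝ → H} (hX : ContinuousOn X (Ici 0)) (hV : IsTimeDeriv X V)
    (hd : ∀ᵐ t ∂(volume.restrict (Ioi (0 : ℝ))),
      ∃ f' ≤ (0 : ℝ), HasLineDerivAt ℝ F f' (X t) (V t))
    {a b : ℝ} (ha : 0 ≤ a) (hab : a ≤ b) : F (X b) ≤ F (X a) := by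
  have key : ∀ a b : ℝ, 0 < a → a ≤ b → F (X b) ≤ F (X a) := by
    intro a b ha hab
    have hVi := (hV a b ha hab).1
    -- Compactness of the trajectory on `[a, b]` provides one Lipschitz constant for all of it; then
    -- `K ∫ ‖V‖` dominates the increments of `F ∘ X`.
    have hcompact : IsCompact (X '' Icc a b) :=
      isCompact_Icc.image_of_continuousOn (hX.mono fun t ht => ha.le.trans ht.1)
    obtain ⟨K, hK⟩ := hF.locallyLipschitzOn.exists_lipschitzOnWith_of_compact hcompact
    have hac : AbsolutelyContinuousOnInterval (fun t => F (X t)) a b := by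
      refine absolutelyContinuousOnInterval_of_dist_le
        ((hVi.norm.absolutelyContinuousOnInterval_intervalIntegral
          (c := a) left_mem_uIcc).const_mul (K : ℝ)) ?_
      have hle : ∀ s ∈ Icc a b, ∀ t ∈ Icc a b, s ≤ t → dist (F (X s)) (F (X t)) ≤
          dist (K * ∫ r in a..s, ‖V r‖) (K * ∫ r in a..t, ‖V r‖) := by
        intro s hs t ht hst
        have hint : ∀ r ∈ Icc a b, IntervalIntegrable (fun r => ‖V r‖) volume a r := fun r hr =>
          hVi.norm.mono_set (uIcc_subset_uIcc left_mem_uIcc (by rwa [uIcc_of_le hab]))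
        have h1 := hK.dist_le_mul _ (mem_image_of_mem X hs) _ (mem_image_of_mem X ht)
        have h2 : dist (X s) (X t) ≤ ∫ r in s..t, ‖V r‖ := by
          rw [dist_comm, dist_eq_norm, (hV s t (ha.trans_le hs.1) hst).2]
          exact intervalIntegral.norm_integral_le_integral_norm hst
        have h3 := intervalIntegral.integral_interval_sub_left (hint t ht) (hint s hs)
        rw [dist_comm (K * _ : ℝ), Real.dist_eq (K * _ : ℝ), ← mul_sub, h3]
        exact h1.trans ((mul_le_mul_of_nonneg_left h2 K.2).trans (le_abs_self _))
      intro s hs t ht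
      rw [uIcc_of_le hab] at hs ht
      rcases le_total s t with h | h
      · exact hle s hs t ht h
      · rw [dist_comm, dist_comm (K * _ : ℝ)]
        exact hle t ht s hs h
    refine AbsolutelyContinuousOnInterval.le_of_ae_deriv_nonpos hab hac ?_
    rw [ae_restrict_iff' measurableSet_Ioi] at hd
    -- Lebesgue differentiation: at almost every time `X` has the classical derivative `V t`.
    filter_upwards [hd, hVi.ae_hasDerivAt_integral] with t ht1 ht2 htab
    obtain ⟨f', hf', hline⟩ := ht1 (ha.trans htab.1)
    have hder := (ht2 (by rw [uIcc_of_le hab]; exact Ioo_subset_Icc_self htab) a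
      left_mem_uIcc).const_add (X a)
    have hXd : HasDerivAt X (V t) t := by
      refine hder.congr_of_eventuallyEq ?_
      filter_upwards [Ioi_mem_nhds htab.1] with s hs
      rw [← (hV a s ha (le_of_lt hs)).2, add_sub_cancel]
    exact (hasDerivAt_comp_of_hasLineDerivAt hF hXd hline).deriv.trans_le hf'
  -- `V` need not be integrable up to time 0, so the case `a = 0` is a limit using continuity of `X`
  -- at 0.
  rcases ha.eq_or_lt with rfl | ha
  · rcases hab.eq_or_lt with rfl | hb
    · rfl
    have hcont : ContinuousWithinAt (fun t => F (X t)) (Ici 0) 0 :=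
      hF.continuous.continuousAt.comp_continuousWithinAt (hX 0 self_mem_Ici)
    refine ge_of_tendsto (hcont.mono_left (nhdsWithin_mono _ Ioi_subset_Ici_self)) ?_
    filter_upwards [Ioc_mem_nhdsGT hb] with s hs
    exact key s b hs.1 hs.2
  · exact key a b ha hab

end Evolution

/-! ### One-homogeneous functions that are C¹ off the origin -/

section Homogeneous

variable {G : Type} [NormedAddCommGroup G] [NormedSpace ℝ G] {h : G → ℝ}

lemma differentiableAt_of_contDiffOn_compl_zero (hc : ContDiffOn ℝ 1 h {0}ᶜ) {p : G}
    (hp : p ≠ 0) : DifferentiableAt ℝ h p :=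
  (hc.differentiableOn one_ne_zero).differentiableAt (isOpen_compl_singleton.mem_nhds hp)

/-- Differentiate `h x = c * h (c⁻¹ • x)`: the outer and inner factors cancel. -/
lemma fderiv_smul_of_homogeneous (hh : ∀ c : ℝ, 0 < c → ∀ p, h (c • p) = c * h p)
    (hc : ContDiffOn ℝ 1 h {0}ᶜ) {c : ℝ} (hc0 : 0 < c) {p : G} (hp : p ≠ 0) :
    fderiv ℝ h (c • p) = fderiv ℝ h p := by
  have h1 : HasFDerivAt h (fderiv ℝ h p) (c⁻¹ • c • p) := by
    rw [inv_smul_smul₀ hc0.ne']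
    exact (differentiableAt_of_contDiffOn_compl_zero hc hp).hasFDerivAt
  have h2 : HasFDerivAt (fun x : G => c⁻¹ • x) (c⁻¹ • ContinuousLinearMap.id ℝ G) (c • p) :=
    (hasFDerivAt_id _).const_smul c⁻¹
  have h3 := (h1.comp (c • p) h2).const_mul c
  have h4 : (fun x => c * (h ∘ fun x : G => c⁻¹ • x) x) = h := by
    ext x
    rw [Function.comp_apply, ← hh c hc0, smul_inv_smul₀ hc0.ne']
  rw [h4] at h3
  rw [h3.fderiv]
  ext v
  simp [hc0.ne']

/-- Euler's identity. -/
lemma fderiv_apply_self_of_homogeneous (hh : ∀ c : ℝ, 0 < c → ∀ p, h (c • p) = c * h p)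
    (hc : ContDiffOn ℝ 1 h {0}ᶜ) {p : G} (hp : p ≠ 0) : fderiv ℝ h p p = h p := by
  have h1 : HasDerivAt (fun t : ℝ => h (p + t • p)) (fderiv ℝ h p p) 0 :=
    (differentiableAt_of_contDiffOn_compl_zero hc hp).hasFDerivAt.hasLineDerivAt p
  have h2 : HasDerivAt (fun t : ℝ => (1 + t) * h p) (1 * h p) 0 :=
    ((hasDerivAt_id (0 : ℝ)).const_add 1).mul_const (h p)
  have h3 : (fun t : ℝ => h (p + t • p)) =ᶠ[𝓝 0] fun t : ℝ => (1 + t) * h p := by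
    filter_upwards [Ioi_mem_nhds (show (-1 : ℝ) < 0 by norm_num)] with t ht
    rw [← hh _ (by linarith [mem_Ioi.1 ht]), add_smul, one_smul]
  rw [h1.unique (h2.congr_of_eventuallyEq h3), one_mul]

/-- The derivative is invariant under positive scaling, so its maximum over the compact unit sphere
bounds it everywhere off 0. -/
lemma exists_bound_fderiv_of_homogeneous [FiniteDimensional ℝ G]
    (hh : ∀ c : ℝ, 0 < c → ∀ p, h (c • p) = c * h p) (hc : ContDiffOn ℝ 1 h {0}ᶜ) :
    ∃ L : ℝ≥0, ∀ p : G, p ≠ 0 → ‖fderiv ℝ h p‖ ≤ L := by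
  have hcont : ContinuousOn (fderiv ℝ h) {0}ᶜ :=
    hc.continuousOn_fderiv_of_isOpen isOpen_compl_singleton le_rfl
  obtain ⟨L, hL⟩ := (isCompact_sphere (0 : G) 1).exists_bound_of_continuousOn
    (hcont.mono fun x hx => by
      rintro rfl
      simp at hx)
  refine ⟨L.toNNReal, fun p hp => le_trans ?_ (Real.le_coe_toNNReal L)⟩
  rw [← fderiv_smul_of_homogeneous hh hc (inv_pos.2 (norm_pos_iff.2 hp)) hp]
  exact hL _ (by simp [norm_smul, hp])

lemma exists_lipschitzWith_of_homogeneous [FiniteDimensional ℝ G]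
    (hh : ∀ c : ℝ, 0 < c → ∀ p, h (c • p) = c * h p) (hc : ContDiffOn ℝ 1 h {0}ᶜ) :
    ∃ L : ℝ≥0, LipschitzWith L h := by
  obtain ⟨L, hL⟩ := exists_bound_fderiv_of_homogeneous hh hc
  have h0 : h 0 = 0 := by
    have := hh 2 two_pos 0
    rw [smul_zero] at this
    linarith
  have hbd : ∀ p, ‖h p‖ ≤ L * ‖p‖ := by
    intro p
    rcases eq_or_ne p 0 with rfl | hp
    · simp [h0]
    · rw [← fderiv_apply_self_of_homogeneous hh hc hp]
      exact ContinuousLinearMap.le_of_opNorm_le _ (hL p hp) p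
  refine ⟨L, LipschitzWith.of_dist_le_mul fun p q => ?_⟩
  -- The mean value inequality fails to apply only if the segment meets 0; then `dist p q = ‖p‖ +
  -- ‖q‖` and the linear growth bound `hbd` suffices.
  by_cases hz : (0 : G) ∈ segment ℝ p q
  · have h1 := dist_add_dist_of_mem_segment hz
    rw [dist_zero_right, dist_zero_left] at h1
    rw [← h1, mul_add, dist_eq_norm]
    exact (norm_sub_le _ _).trans (add_le_add (hbd p) (hbd q))
  · rw [dist_comm, dist_comm p, dist_eq_norm, dist_eq_norm]
    have hne : ∀ x ∈ segment ℝ p q, x ≠ 0 := fun x hx h => hz (h ▸ hx)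
    exact (convex_segment p q).norm_image_sub_le_of_norm_fderiv_le
      (fun x hx => differentiableAt_of_contDiffOn_compl_zero hc (hne x hx))
      (fun x hx => hL x (hne x hx)) (left_mem_segment ℝ p q) (right_mem_segment ℝ p q)

end Homogeneous

/-! ### The homogeneous extension and the rotated tangent -/

section HomExt

variable (γ : Plane → ℝ)

lemma homExt_smul (c : ℝ) (hc : 0 < c) (p : Plane) : homExt γ (c • p) = c * homExt γ p := by
  rw [homExt, homExt, norm_smul, Real.norm_of_nonneg hc.le, smul_smul, mul_inv, mul_assoc,
    mul_right_comm, inv_mul_cancel₀ hc.ne', one_mul]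

lemma homExt_of_norm_eq_one {n : Plane} (hn : ‖n‖ = 1) : homExt γ n = γ n := by
  simp [homExt, hn]

/-- Clockwise rotation as a continuous linear map. -/
noncomputable def perpL : Plane →L[ℝ] Plane :=
  LinearMap.toContinuousLinearMap
    { toFun := perp
      map_add' := fun u v => by
        ext i
        fin_cases i <;> simp [perp]
        ring
      map_smul' := fun c v => by
        ext i
        fin_cases i <;> simp [perp] }

lemma perpL_apply (v : Plane) : perpL v = perp v := rfl

lemma norm_perp (v : Plane) : ‖perp v‖ = ‖v‖ := by
  simp [EuclideanSpace.norm_eq, Fin.sum_univ_two, perp, add_comm]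

lemma perp_smul (c : ℝ) (v : Plane) : perp (c • v) = c • perp v := perpL.map_smul c v

lemma normal_eq (X : H1 Plane) (ρ : ℝ) :
    normal X ρ = ‖-perp (dρ X ρ)‖⁻¹ • -perp (dρ X ρ) := by
  rw [normal, ds, arcDensity, perp_smul, norm_neg, norm_perp, smul_neg]

/-- Homogeneity absorbs the arc-length density. No regularity of the curve is needed: where ∂_ρ X =
0 both integrands vanish. -/
lemma energy_eq (X : H1 Plane) :
    energy γ X = ∫ ρ, homExt γ (-perp (dρ X ρ)) ∂torusMeasure := by
  refine integral_congr_ae (Eventually.of_forall fun ρ => ?_)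
  simp only [homExt]
  rw [← normal_eq, norm_neg, norm_perp, mul_comm, arcDensity]

end HomExt

/-! ### Basic facts on H¹ of the torus -/

section SobolevBasics

variable {E : Type} [NormedAddCommGroup E] [NormedSpace ℝ E]

lemma memLp_fn (u : H1 E) : MemLp (fn u) 2 torusMeasure := Lp.memLp _

lemma memLp_dρ (u : H1 E) : MemLp (dρ u) 2 torusMeasure := Lp.memLp _

lemma integrable_dρ (u : H1 E) : Integrable (dρ u) torusMeasure :=
  (memLp_dρ u).integrable one_le_two

lemma isWeakDeriv_fn_dρ (u : H1 E) : IsWeakDeriv (fn u) (dρ u) := u.2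

lemma integral_norm_le_norm_L2 {F : Type} [NormedAddCommGroup F] (u : L2 F) : ∫ ρ, ‖u ρ‖ ∂torusMeasure ≤ ‖u‖ := by
  have hi : Integrable (fun ρ => u ρ) torusMeasure := (Lp.memLp u).integrable one_le_two
  rw [integral_norm_eq_lintegral_enorm hi.aestronglyMeasurable,
    ← eLpNorm_one_eq_lintegral_enorm, Lp.norm_def]
  exact ENNReal.toReal_mono (Lp.eLpNorm_ne_top u)
    (eLpNorm_le_eLpNorm_of_exponent_le one_le_two hi.aestronglyMeasurable)

lemma dρ_sub (u v : H1 E) : dρ (u - v) =ᵐ[torusMeasure] fun ρ => dρ u ρ - dρ v ρ :=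
  Lp.coeFn_sub _ _

lemma dρ_add_smul (u v : H1 E) (t : ℝ) :
    dρ (u + t • v) =ᵐ[torusMeasure] fun ρ => dρ u ρ + t • dρ v ρ := by
  filter_upwards [Lp.coeFn_add (u : WithLp 2 (L2 E × L2 E)).snd
    (t • (v : WithLp 2 (L2 E × L2 E)).snd),
    Lp.coeFn_smul t (v : WithLp 2 (L2 E × L2 E)).snd] with ρ h1 h2
  rw [Pi.add_apply, h2] at h1
  exact h1

lemma integral_norm_dρ_sub_le (u v : H1 E) :
    ∫ ρ, ‖dρ u ρ - dρ v ρ‖ ∂torusMeasure ≤ dist u v := by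
  have h1 : ∫ ρ, ‖dρ u ρ - dρ v ρ‖ ∂torusMeasure = ∫ ρ, ‖dρ (u - v) ρ‖ ∂torusMeasure := by
    refine integral_congr_ae ?_
    filter_upwards [dρ_sub u v] with ρ h
    rw [h]
  rw [h1, dist_eq_norm]
  exact (integral_norm_le_norm_L2 _).trans (WithLp.norm_snd_le _ _)

end SobolevBasics

/-! ### Lipschitz bound and line derivative of the energy -/

section Energy

variable {γ : Plane → ℝ}

lemma exists_lipschitzWith_homExt_perp (hγ : ContDiffOn ℝ 1 (homExt γ) {0}ᶜ) :
    ∃ L : ℝ≥0, LipschitzWith L fun v => homExt γ (-perp v) := by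
  obtain ⟨L, hL⟩ := exists_lipschitzWith_of_homogeneous (homExt_smul γ) hγ
  refine ⟨L, LipschitzWith.of_dist_le_mul fun u v => (hL.dist_le_mul _ _).trans_eq ?_⟩
  rw [dist_neg_neg, dist_eq_norm, dist_eq_norm, ← norm_perp (u - v), ← perpL_apply,
    ← perpL_apply, ← perpL_apply, map_sub]

lemma integrable_homExt_perp (hγ : ContDiffOn ℝ 1 (homExt γ) {0}ᶜ) {f : ℝ → Plane}
    (hf : Integrable f torusMeasure) :
    Integrable (fun ρ => homExt γ (-perp (f ρ))) torusMeasure := by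
  obtain ⟨L, hL⟩ := exists_lipschitzWith_homExt_perp hγ
  refine (hf.norm.const_mul (L : ℝ)).mono' (hL.continuous.comp_aestronglyMeasurable hf.1)
    (Eventually.of_forall fun ρ => ?_)
  have h0 : homExt γ (-perp 0) = 0 := by
    rw [← perpL_apply, map_zero, neg_zero, homExt, norm_zero, zero_mul]
  simpa only [dist_eq_norm, h0, sub_zero] using hL.dist_le_mul (f ρ) 0

lemma exists_lipschitzWith_energy (hγ : ContDiffOn ℝ 1 (homExt γ) {0}ᶜ) :
    ∃ L : ℝ≥0, LipschitzWith L (energy γ) := by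
  obtain ⟨L, hL⟩ := exists_lipschitzWith_homExt_perp hγ
  refine ⟨L, LipschitzWith.of_dist_le_mul fun u v => ?_⟩
  rw [energy_eq, energy_eq, dist_eq_norm, ← integral_sub
    (integrable_homExt_perp hγ (integrable_dρ u)) (integrable_homExt_perp hγ (integrable_dρ v))]
  calc _ ≤ ∫ ρ, L * ‖dρ u ρ - dρ v ρ‖ ∂torusMeasure := by
        refine norm_integral_le_of_norm_le
          (((integrable_dρ u).sub (integrable_dρ v)).norm.const_mul _)
          (Eventually.of_forall fun ρ => ?_)
        simpa [dist_eq_norm] using hL.dist_le_mul (dρ u ρ) (dρ v ρ)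
    _ ≤ L * dist u v := by
        rw [integral_const_mul]
        exact mul_le_mul_of_nonneg_left (integral_norm_dρ_sub_le u v) L.2

/-- Differentiation under the integral, with the Lipschitz bound `L * ‖∂_ρ V‖` as dominating
function. -/
lemma hasLineDerivAt_energy (hγ : ContDiffOn ℝ 1 (homExt γ) {0}ᶜ) {X : H1 Plane} (V : H1 Plane)
    (hX : ∀ᵐ ρ ∂torusMeasure, dρ X ρ ≠ 0) :
    HasLineDerivAt ℝ (energy γ)
      (∫ ρ, fderiv ℝ (homExt γ) (-perp (dρ X ρ)) (-perp (dρ V ρ)) ∂torusMeasure) X V := by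
  obtain ⟨L, hL⟩ := exists_lipschitzWith_homExt_perp hγ
  have hfun : (fun t : ℝ => energy γ (X + t • V)) =
      fun t : ℝ => ∫ ρ, homExt γ (-perp (dρ X ρ + t • dρ V ρ)) ∂torusMeasure := by
    ext t
    rw [energy_eq]
    refine integral_congr_ae ?_
    filter_upwards [dρ_add_smul X V t] with ρ h
    rw [h]
  have hint : ∀ t : ℝ, Integrable (fun ρ => homExt γ (-perp (dρ X ρ + t • dρ V ρ))) torusMeasure :=
    fun t => integrable_homExt_perp hγ ((integrable_dρ X).add ((integrable_dρ V).smul t))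
  have hmeas : ∀ u : H1 Plane, AEStronglyMeasurable (fun ρ => -perp (dρ u ρ)) torusMeasure :=
    fun u => (perpL.continuous.neg.comp_aestronglyMeasurable (integrable_dρ u).1)
  rw [HasLineDerivAt, hfun]
  refine (hasDerivAt_integral_of_dominated_loc_of_lip (s := univ) (x₀ := (0 : ℝ))
    (F := fun t ρ => homExt γ (-perp (dρ X ρ + t • dρ V ρ)))
    (bound := fun ρ => L * ‖dρ V ρ‖) univ_mem
    (Eventually.of_forall fun t => (hint t).1) (hint 0) ?_ (Eventually.of_forall fun ρ => ?_)
    ((integrable_dρ V).norm.const_mul _) ?_).2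
  · have h1 : AEStronglyMeasurable (fun ρ => fderiv ℝ (homExt γ) (-perp (dρ X ρ))) torusMeasure :=
      ((measurable_fderiv ℝ (homExt γ)).comp_aemeasurable
        (hmeas X).aemeasurable).aestronglyMeasurable
    exact (ContinuousLinearMap.id ℝ (Plane →L[ℝ] ℝ)).aestronglyMeasurable_comp₂ h1 (hmeas V)
  · refine LipschitzOnWith.of_dist_le_mul fun s _ t _ => (hL.dist_le_mul _ _).trans_eq ?_
    rw [dist_add_left, dist_eq_norm, ← sub_smul, norm_smul, Real.coe_nnabs,
      abs_of_nonneg (by positivity), dist_eq_norm]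
    ring
  -- Pointwise differentiability is required only at parameter 0, so it is harmless that ∂_ρ X + t
  -- ∂_ρ V may vanish for other t.
  · filter_upwards [hX] with ρ hρ
    have hne : -perp (dρ X ρ) ≠ 0 := by
      rw [← norm_ne_zero_iff, norm_neg, norm_perp, norm_ne_zero_iff]
      exact hρ
    have := (differentiableAt_of_contDiffOn_compl_zero hγ hne).hasFDerivAt.hasLineDerivAt
      (-perp (dρ V ρ))
    rw [HasLineDerivAt] at this
    convert this using 3 with t
    rw [← perpL_apply, ← perpL_apply, ← perpL_apply, map_add, map_smul, neg_add, smul_neg]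

end Energy

/-! ### Integration by parts through Fourier series -/

section IntegrationByParts

lemma integrable_continuous_mul {ψ : ℝ → ℝ} (hψ : Continuous ψ) {f : ℝ → ℝ}
    (hf : Integrable f torusMeasure) : Integrable (fun ρ => ψ ρ * f ρ) torusMeasure := by
  obtain ⟨C, hC⟩ := exists_bound_torus hψ
  exact hf.bdd_smul C hψ.aestronglyMeasurable hC

/-- Fourier coefficients of a real function through its cosine and sine coefficients. -/
lemma fourierCoeffOn_ofReal {f : ℝ → ℝ} (hf : Integrable f torusMeasure) (n : ℤ) :
    fourierCoeffOn (zero_lt_one' ℝ) (fun x => (f x : ℂ)) n =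
      ((∫ ρ, Real.cos (2 * Real.pi * n * ρ) * f ρ ∂torusMeasure : ℝ) : ℂ)
      - ((∫ ρ, Real.sin (2 * Real.pi * n * ρ) * f ρ ∂torusMeasure : ℝ) : ℂ) * Complex.I := by
  have hc := integrable_continuous_mul (ψ := fun ρ => Real.cos (2 * Real.pi * n * ρ))
    (by fun_prop) hf
  have hs := integrable_continuous_mul (ψ := fun ρ => Real.sin (2 * Real.pi * n * ρ))
    (by fun_prop) hf
  rw [fourierCoeffOn_eq_integral, intervalIntegral.integral_of_le zero_le_one,
    ← integral_complex_ofReal, ← integral_complex_ofReal, ← integral_mul_const,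
    ← integral_sub hc.ofReal (hs.ofReal.mul_const _), sub_zero, div_one, one_smul]
  refine integral_congr_ae (Eventually.of_forall fun ρ => ?_)
  have h : 2 * (Real.pi : ℂ) * Complex.I * ((-n : ℤ) : ℂ) * ρ / ((1 : ℝ) : ℂ) =
      ((-(2 * Real.pi * n * ρ) : ℝ) : ℂ) * Complex.I := by
    push_cast
    ring
  simp only [fourier_coe_apply, smul_eq_mul]
  rw [h, Complex.exp_mul_I, ← Complex.ofReal_cos, ← Complex.ofReal_sin, Real.cos_neg, Real.sin_neg]
  push_cast
  ring

lemma IsWeakDeriv.integral_cos_mul {u g : ℝ → ℝ} (h : IsWeakDeriv u g) (n : ℤ) :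
    ∫ ρ, Real.cos (2 * Real.pi * n * ρ) * g ρ ∂torusMeasure =
      2 * Real.pi * n * ∫ ρ, Real.sin (2 * Real.pi * n * ρ) * u ρ ∂torusMeasure := by
  have h1 := h (fun ρ => Real.cos (2 * Real.pi * n * ρ)) (by fun_prop) (fun ρ => by
    beta_reduce
    rw [mul_add, mul_one, mul_comm (2 * Real.pi) (n : ℝ)]
    exact Real.cos_periodic.int_mul n _)
  have h2 : deriv (fun ρ : ℝ => Real.cos (2 * Real.pi * n * ρ)) =
      fun ρ => -(2 * Real.pi * n * Real.sin (2 * Real.pi * n * ρ)) := by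
    ext ρ
    simp [mul_comm]
  have h3 : ∀ ρ, -(2 * Real.pi * n * Real.sin (2 * Real.pi * n * ρ)) * u ρ =
      -(2 * Real.pi * n) * (Real.sin (2 * Real.pi * n * ρ) * u ρ) := fun ρ => by ring
  simp only [h2, smul_eq_mul] at h1
  simp only [h3, integral_const_mul] at h1
  linarith

lemma IsWeakDeriv.integral_sin_mul {u g : ℝ → ℝ} (h : IsWeakDeriv u g) (n : ℤ) :
    ∫ ρ, Real.sin (2 * Real.pi * n * ρ) * g ρ ∂torusMeasure =
      -(2 * Real.pi * n * ∫ ρ, Real.cos (2 * Real.pi * n * ρ) * u ρ ∂torusMeasure) := by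
  have h1 := h (fun ρ => Real.sin (2 * Real.pi * n * ρ)) (by fun_prop) (fun ρ => by
    beta_reduce
    rw [mul_add, mul_one, mul_comm (2 * Real.pi) (n : ℝ)]
    exact Real.sin_periodic.int_mul n _)
  have h2 : deriv (fun ρ : ℝ => Real.sin (2 * Real.pi * n * ρ)) =
      fun ρ => 2 * Real.pi * n * Real.cos (2 * Real.pi * n * ρ) := by
    ext ρ
    simp [mul_comm]
  have h3 : ∀ ρ, 2 * Real.pi * n * Real.cos (2 * Real.pi * n * ρ) * u ρ =
      2 * Real.pi * n * (Real.cos (2 * Real.pi * n * ρ) * u ρ) := fun ρ => by ring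
  simp only [h2, smul_eq_mul] at h1
  simp only [h3, integral_const_mul] at h1
  linarith

/-- `∫ u u' = 0` on the torus, from Parseval's identity for `u + u'` and `u - u'`, whose Fourier
coefficients have the same modulus. -/
lemma IsWeakDeriv.integral_mul_self_eq_zero {u g : ℝ → ℝ} (h : IsWeakDeriv u g)
    (hu : MemLp u 2 torusMeasure) (hg : MemLp g 2 torusMeasure) :
    ∫ ρ, u ρ * g ρ ∂torusMeasure = 0 := by
  have hui := hu.integrable one_le_two
  have hgi := hg.integrable one_le_two
  -- The coefficients of u ± g are (1 ± 2πin) times those of u, and these two factors have equal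
  -- modulus.
  have hcoeff : ∀ n : ℤ, ‖fourierCoeffOn (zero_lt_one' ℝ) (fun x => ((u x + g x : ℝ) : ℂ)) n‖ ^ 2 =
      ‖fourierCoeffOn (zero_lt_one' ℝ) (fun x => ((u x - g x : ℝ) : ℂ)) n‖ ^ 2 := by
    intro n
    rw [fourierCoeffOn_ofReal (f := fun x => u x + g x) (hui.add hgi),
      fourierCoeffOn_ofReal (f := fun x => u x - g x) (hui.sub hgi)]
    have hc : Continuous fun ρ : ℝ => Real.cos (2 * Real.pi * n * ρ) := by fun_prop
    have hs : Continuous fun ρ : ℝ => Real.sin (2 * Real.pi * n * ρ) := by fun_prop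
    simp only [mul_add, mul_sub]
    rw [integral_add (integrable_continuous_mul hc hui) (integrable_continuous_mul hc hgi),
      integral_add (integrable_continuous_mul hs hui) (integrable_continuous_mul hs hgi),
      integral_sub (integrable_continuous_mul hc hui) (integrable_continuous_mul hc hgi),
      integral_sub (integrable_continuous_mul hs hui) (integrable_continuous_mul hs hgi),
      h.integral_cos_mul, h.integral_sin_mul, Complex.sq_norm, Complex.sq_norm,
      Complex.normSq_apply, Complex.normSq_apply]
    simp only [Complex.sub_re, Complex.sub_im, Complex.ofReal_re, Complex.ofReal_im,
      Complex.re_ofReal_mul, Complex.im_ofReal_mul, Complex.I_re, Complex.I_im]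
    ring
  have hp := tsum_sq_fourierCoeffOn (zero_lt_one' ℝ) (hu.add hg).ofReal
  have hm := tsum_sq_fourierCoeffOn (zero_lt_one' ℝ) (hu.sub hg).ofReal
  have heq : ∫ ρ, (u ρ + g ρ) ^ 2 ∂torusMeasure = ∫ ρ, (u ρ - g ρ) ^ 2 ∂torusMeasure := by
    have := hp.symm.trans ((tsum_congr hcoeff).trans hm)
    simpa [intervalIntegral.integral_of_le, ← Complex.ofReal_add, ← Complex.ofReal_sub,
      Complex.norm_real] using this
  have hsub := integral_sub (hu.add hg).integrable_sq (hu.sub hg).integrable_sq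
  simp only [Pi.add_apply, Pi.sub_apply] at hsub
  rw [heq, sub_self] at hsub
  have h4 : ∀ ρ, (u ρ + g ρ) ^ 2 - (u ρ - g ρ) ^ 2 = 4 * (u ρ * g ρ) := fun ρ => by ring
  simp only [h4, integral_const_mul] at hsub
  linarith

/-- Serves to polarize ∫ u u' = 0 by applying it to u + v. -/
lemma IsWeakDeriv.add {u g v w : ℝ → ℝ} (h : IsWeakDeriv u g) (h' : IsWeakDeriv v w)
    (hu : Integrable u torusMeasure) (hg : Integrable g torusMeasure)
    (hv : Integrable v torusMeasure) (hw : Integrable w torusMeasure) :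
    IsWeakDeriv (fun ρ => u ρ + v ρ) (fun ρ => g ρ + w ρ) := by
  intro φ hφ hper
  have hd : Continuous (deriv φ) := hφ.continuous_deriv (by simp)
  have h1 := h φ hφ hper
  have h2 := h' φ hφ hper
  simp only [smul_eq_mul, mul_add] at h1 h2 ⊢
  rw [integral_add (integrable_continuous_mul hd hu) (integrable_continuous_mul hd hv),
    integral_add (integrable_continuous_mul hφ.continuous hg)
      (integrable_continuous_mul hφ.continuous hw), h1, h2, neg_add]

/-- Integration by parts for weakly differentiable functions on the torus. -/
lemma IsWeakDeriv.integral_mul_eq_neg {u g v w : ℝ → ℝ} (h : IsWeakDeriv u g)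
    (h' : IsWeakDeriv v w) (hu : MemLp u 2 torusMeasure) (hg : MemLp g 2 torusMeasure)
    (hv : MemLp v 2 torusMeasure) (hw : MemLp w 2 torusMeasure) :
    ∫ ρ, u ρ * w ρ ∂torusMeasure = -∫ ρ, g ρ * v ρ ∂torusMeasure := by
  have h0 := (h.add h' (hu.integrable one_le_two) (hg.integrable one_le_two)
    (hv.integrable one_le_two) (hw.integrable one_le_two)).integral_mul_self_eq_zero
    (hu.add hv) (hg.add hw)
  have h4 : ∀ ρ, (u ρ + v ρ) * (g ρ + w ρ) =
      (u ρ * g ρ + v ρ * w ρ) + (u ρ * w ρ + g ρ * v ρ) := fun ρ => by ring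
  have iug : Integrable (fun ρ => u ρ * g ρ) torusMeasure := hu.integrable_mul hg
  have ivw : Integrable (fun ρ => v ρ * w ρ) torusMeasure := hv.integrable_mul hw
  have iuw : Integrable (fun ρ => u ρ * w ρ) torusMeasure := hu.integrable_mul hw
  have igv : Integrable (fun ρ => g ρ * v ρ) torusMeasure := hg.integrable_mul hv
  simp only [h4] at h0
  rw [integral_add (f := fun ρ => u ρ * g ρ + v ρ * w ρ)
    (g := fun ρ => u ρ * w ρ + g ρ * v ρ) (iug.add ivw) (iuw.add igv), integral_add iug ivw, integral_add iuw igv,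
    h.integral_mul_self_eq_zero hu hg, h'.integral_mul_self_eq_zero hv hw] at h0
  linarith

lemma IsWeakDeriv.comp_clm {E F : Type} [NormedAddCommGroup E] [NormedSpace ℝ E] [CompleteSpace E]
    [NormedAddCommGroup F] [NormedSpace ℝ F] [CompleteSpace F] (L : E →L[ℝ] F) (u : H1 E) :
    IsWeakDeriv (fun ρ => L (fn u ρ)) (fun ρ => L (dρ u ρ)) := by
  intro φ hφ hper
  have h := congrArg L (isWeakDeriv_fn_dρ u φ hφ hper)
  have h1 : Integrable (fun ρ => deriv φ ρ • fn u ρ) torusMeasure :=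
    integrable_smul_L2 (hφ.continuous_deriv (by simp)) _
  have h2 : Integrable (fun ρ => φ ρ • dρ u ρ) torusMeasure :=
    integrable_smul_L2 hφ.continuous _
  rw [map_neg, ← L.integral_comp_comm h1, ← L.integral_comp_comm h2] at h
  simpa only [map_smul] using h

end IntegrationByParts

/-! ### The surface energy matrix and energy dissipation -/

section Dissipation

/-- Put n = -τ^⊥. As n·τ = 0, the terms ξnᵀ and k nnᵀ annihilate τ, and Euler's identity `hE` leaves
(ξ·n)τ - (ξ·τ)n. This is ξ^⊥, and ξ^⊥·w = -ξ·w^⊥. -/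
lemma inner_surfaceEnergyMatrix (γ k : Plane → ℝ) {τ : Plane} (hτ : ‖τ‖ = 1)
    (hE : inner ℝ (cahnHoffman γ (-perp τ)) (-perp τ) = γ (-perp τ)) (w : Plane) :
    inner ℝ (Matrix.toEuclideanLin (surfaceEnergyMatrix γ k (-perp τ)) τ) w =
      inner ℝ (cahnHoffman γ (-perp τ)) (-perp w) := by
  have h1 : τ 0 ^ 2 + τ 1 ^ 2 = 1 := by
    rw [← Fin.sum_univ_two (fun i => τ i ^ 2), ← EuclideanSpace.real_norm_sq_eq, hτ, one_pow]
  unfold surfaceEnergyMatrix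
  rw [← hE]
  generalize cahnHoffman γ (-perp τ) = ξ
  generalize k (-perp τ) = κ
  simp only [PiLp.inner_apply, Fin.sum_univ_two, Matrix.toLpLin_apply, Matrix.mulVec, dotProduct,
    Matrix.add_apply, Matrix.sub_apply, Matrix.smul_apply, Matrix.vecMulVec_apply]
  simp [perp]
  linear_combination (ξ 1 * w 0 - ξ 0 * w 1) * h1

/-- Scale invariance of the gradient replaces -(∂_ρ X)^⊥ by the unit normal; the arc-length density
cancels the one in ∂_s V. -/
lemma fderiv_homExt_eq_inner {γ : Plane → ℝ} (k : Plane → ℝ)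
    (hγ : ContDiffOn ℝ 1 (homExt γ) {0}ᶜ) {X : H1 Plane} (V : H1 Plane) {ρ : ℝ}
    (hρ : dρ X ρ ≠ 0) :
    fderiv ℝ (homExt γ) (-perp (dρ X ρ)) (-perp (dρ V ρ)) =
      inner ℝ (Matrix.toEuclideanLin (surfaceEnergyMatrix γ k (normal X ρ)) (ds X X ρ))
        (ds X V ρ) * arcDensity X ρ := by
  have hpos : 0 < ‖dρ X ρ‖ := norm_pos_iff.2 hρ
  have hτ : ‖ds X X ρ‖ = 1 := by
    rw [ds, arcDensity, norm_smul, norm_inv, norm_norm, inv_mul_cancel₀ hpos.ne']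
  have hn : ‖-perp (ds X X ρ)‖ = 1 := by rw [norm_neg, norm_perp, hτ]
  have hn0 : -perp (ds X X ρ) ≠ 0 := by
    rw [← norm_ne_zero_iff, hn]
    exact one_ne_zero
  have hgrad : ∀ v, inner ℝ (cahnHoffman γ (-perp (ds X X ρ))) v =
      fderiv ℝ (homExt γ) (-perp (ds X X ρ)) v := fun v => by
    rw [cahnHoffman, gradient, InnerProductSpace.toDual_symm_apply]
  have hp : -perp (dρ X ρ) = ‖dρ X ρ‖ • -perp (ds X X ρ) := by
    rw [ds, arcDensity, perp_smul, smul_neg, smul_inv_smul₀ hpos.ne']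
  have hV : ds X V ρ = ‖dρ X ρ‖⁻¹ • dρ V ρ := rfl
  rw [normal, inner_surfaceEnergyMatrix γ k hτ, hgrad, hp,
    fderiv_smul_of_homogeneous (homExt_smul γ) hγ hpos hn0, hV, arcDensity, perp_smul, ← smul_neg,
    map_smul, smul_eq_mul, mul_comm, mul_inv_cancel_left₀ hpos.ne']
  rw [hgrad, fderiv_apply_self_of_homogeneous (homExt_smul γ) hγ hn0, homExt_of_norm_eq_one γ hn]

/-- Testing the first equation with `μ` and the second one with the velocity shows that the energy
decays with rate `∫ |∂_s μ|² ds`. -/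
lemma WeakEquations.hasLineDerivAt_energy {γ k : Plane → ℝ}
    (hγ : ContDiffOn ℝ 1 (homExt γ) {0}ᶜ) {X V : H1 Plane} {μ : H1 ℝ}
    (h : WeakEquations γ k X V μ) (hX : ∀ᵐ ρ ∂torusMeasure, dρ X ρ ≠ 0) :
    HasLineDerivAt ℝ (energy γ) (-curveInner X (ds X μ) (ds X μ)) X V := by
  convert SurfaceDiffusion.hasLineDerivAt_energy hγ V hX using 1
  have h1 := h.1 μ
  have h2 := h.2 V
  have h3 : curveInner X (fun ρ => inner ℝ (normal X ρ) (fn V ρ)) (fn μ) =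
      curveInner X (fun ρ => fn μ ρ • normal X ρ) (fn V) := by
    simp only [curveInner, real_inner_smul_left, RCLike.inner_apply, conj_trivial]
  have h4 : ∫ ρ, fderiv ℝ (homExt γ) (-perp (dρ X ρ)) (-perp (dρ V ρ)) ∂torusMeasure =
      curveInner X
        (fun ρ => Matrix.toEuclideanLin (surfaceEnergyMatrix γ k (normal X ρ)) (ds X X ρ))
        (ds X V) := by
    refine integral_congr_ae ?_
    filter_upwards [hX] with ρ hρ
    exact fderiv_homExt_eq_inner k hγ V hρ
  rw [h4]
  linarith

lemma curveInner_self_nonneg {F : Type} [NormedAddCommGroup F] [InnerProductSpace ℝ F]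
    (X : H1 Plane) (u : ℝ → F) : 0 ≤ curveInner X u u :=
  integral_nonneg fun _ => mul_nonneg real_inner_self_nonneg (norm_nonneg _)

end Dissipation

/-! ### The area functional and its stationarity -/

section Area

/-- The coordinates of a curve, as continuous linear maps into `L²(𝕋)`. -/
noncomputable def fnCoord (i : Fin 2) : H1 Plane →L[ℝ] L2 ℝ :=
  ((EuclideanSpace.proj i : Plane →L[ℝ] ℝ).compLpL 2 torusMeasure).comp
    ((WithLp.fstL 2 ℝ (L2 Plane) (L2 Plane)).comp (H1 Plane).subtypeL)

/-- The coordinates of the weak derivative, as continuous linear maps of the curve. -/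
noncomputable def dρCoord (i : Fin 2) : H1 Plane →L[ℝ] L2 ℝ :=
  ((EuclideanSpace.proj i : Plane →L[ℝ] ℝ).compLpL 2 torusMeasure).comp
    ((WithLp.sndL 2 ℝ (L2 Plane) (L2 Plane)).comp (H1 Plane).subtypeL)

lemma coeFn_fnCoord (i : Fin 2) (X : H1 Plane) :
    fnCoord i X =ᵐ[torusMeasure] fun ρ => fn X ρ i :=
  ContinuousLinearMap.coeFn_compLp _ _

lemma coeFn_dρCoord (i : Fin 2) (X : H1 Plane) :
    dρCoord i X =ᵐ[torusMeasure] fun ρ => dρ X ρ i :=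
  ContinuousLinearMap.coeFn_compLp _ _

lemma inner_fnCoord_dρCoord (i j : Fin 2) (X Y : H1 Plane) :
    inner ℝ (fnCoord i X) (dρCoord j Y) = ∫ ρ, fn X ρ i * dρ Y ρ j ∂torusMeasure := by
  rw [MeasureTheory.L2.inner_def]
  refine integral_congr_ae ?_
  filter_upwards [coeFn_fnCoord i X, coeFn_dρCoord j Y] with ρ h1 h2
  rw [h1, h2, RCLike.inner_apply, conj_trivial, mul_comm]

lemma memLp_fn_coord (X : H1 Plane) (i : Fin 2) : MemLp (fun ρ => fn X ρ i) 2 torusMeasure :=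
  (EuclideanSpace.proj i : Plane →L[ℝ] ℝ).comp_memLp' (memLp_fn X)

lemma memLp_dρ_coord (X : H1 Plane) (i : Fin 2) : MemLp (fun ρ => dρ X ρ i) 2 torusMeasure :=
  (EuclideanSpace.proj i : Plane →L[ℝ] ℝ).comp_memLp' (memLp_dρ X)

lemma area_eq_inner : area = fun X => inner ℝ (fnCoord 1 X) (dρCoord 0 X) := by
  ext X
  rw [inner_fnCoord_dρCoord, area]

lemma contDiff_area : ContDiff ℝ 1 area := by
  rw [area_eq_inner]
  exact (fnCoord 1).contDiff.inner ℝ (dρCoord 0).contDiff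

/-- The product rule gives ∫ (V_y ∂_ρ x + y ∂_ρ V_x); integrating the second term by parts removes
the derivative from V. -/
lemma hasLineDerivAt_area (X V : H1 Plane) :
    HasLineDerivAt ℝ area
      (∫ ρ, (fn V ρ 1 * dρ X ρ 0 - fn V ρ 0 * dρ X ρ 1) ∂torusMeasure) X V := by
  have hline : ∀ L : H1 Plane →L[ℝ] L2 ℝ, HasDerivAt (fun t : ℝ => L (X + t • V)) (L V) 0 :=
    fun L => L.hasFDerivAt.hasLineDerivAt V
  have h := (hline (fnCoord 1)).inner ℝ (hline (dρCoord 0))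
  rw [HasLineDerivAt, area_eq_inner]
  refine h.congr_deriv ?_
  have hw : ∀ (u : H1 Plane) (i : Fin 2),
      IsWeakDeriv (fun ρ => fn u ρ i) (fun ρ => dρ u ρ i) := fun u i =>
    IsWeakDeriv.comp_clm (EuclideanSpace.proj i : Plane →L[ℝ] ℝ) u
  rw [zero_smul, add_zero, inner_fnCoord_dρCoord, inner_fnCoord_dρCoord,
    (hw X 1).integral_mul_eq_neg (hw V 0) (memLp_fn_coord X 1) (memLp_dρ_coord X 1)
      (memLp_fn_coord V 0) (memLp_dρ_coord V 0),
    integral_sub (f := fun ρ => fn V ρ 1 * dρ X ρ 0) (g := fun ρ => fn V ρ 0 * dρ X ρ 1)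
      ((memLp_fn_coord V 1).integrable_mul (memLp_dρ_coord X 0))
      ((memLp_fn_coord V 0).integrable_mul (memLp_dρ_coord X 1))]
  simp only [mul_comm (fn V _ 0)]
  ring

/-- Constant functions belong to `H¹(𝕋)`. -/
lemma exists_H1_eq_one :
    ∃ φ : H1 ℝ, fn φ =ᵐ[torusMeasure] (fun _ => 1) ∧ dρ φ =ᵐ[torusMeasure] fun _ => 0 := by
  have h1 : (Lp.const 2 torusMeasure (1 : ℝ) : ℝ → ℝ) =ᵐ[torusMeasure] fun _ => 1 :=
    Lp.coeFn_const _ _ _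
  have h0 : ((0 : L2 ℝ) : ℝ → ℝ) =ᵐ[torusMeasure] fun _ => 0 := Lp.coeFn_zero _ _ _
  refine ⟨⟨WithLp.toLp 2 (Lp.const 2 torusMeasure (1 : ℝ), 0), ?_⟩, h1, h0⟩
  intro φ hφ hper
  have e1 : ∫ ρ, deriv φ ρ • (Lp.const 2 torusMeasure (1 : ℝ) : ℝ → ℝ) ρ ∂torusMeasure =
      ∫ ρ, deriv φ ρ ∂torusMeasure := by
    refine integral_congr_ae ?_
    filter_upwards [h1] with ρ h
    rw [h, smul_eq_mul, mul_one]
  have e2 : ∫ ρ, φ ρ • ((0 : L2 ℝ) : ℝ → ℝ) ρ ∂torusMeasure = 0 := by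
    refine integral_eq_zero_of_ae ?_
    filter_upwards [h0] with ρ h
    rw [h, smul_zero, Pi.zero_apply]
  have e3 : ∫ ρ, deriv φ ρ ∂torusMeasure = 0 := by
    rw [← intervalIntegral.integral_of_le zero_le_one,
      intervalIntegral.integral_deriv_eq_sub
        (fun x _ => (hφ.differentiable (by simp)).differentiableAt)
        ((hφ.continuous_deriv (by simp)).intervalIntegrable _ _)]
    simpa [sub_eq_zero] using hper 0
  exact e1.trans (e3.trans (neg_eq_zero.2 e2).symm)

/-- Testing the first equation with the constant `1` shows that the area is stationary. -/
lemma WeakEquations.hasLineDerivAt_area {γ k : Plane → ℝ} {X V : H1 Plane} {μ : H1 ℝ}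
    (h : WeakEquations γ k X V μ) (hX : ∀ᵐ ρ ∂torusMeasure, dρ X ρ ≠ 0) :
    HasLineDerivAt ℝ area 0 X V := by
  convert SurfaceDiffusion.hasLineDerivAt_area X V using 1
  obtain ⟨φ, hφ1, hφ0⟩ := exists_H1_eq_one
  have h1 := h.1 φ
  have h2 : curveInner X (ds X μ) (ds X φ) = 0 := by
    refine integral_eq_zero_of_ae ?_
    filter_upwards [hφ0] with ρ hρ
    rw [ds, ds, hρ, smul_zero, inner_zero_right, zero_mul, Pi.zero_apply]
  rw [h2, add_zero] at h1
  rw [← h1]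
  refine integral_congr_ae ?_
  filter_upwards [hφ1, hX] with ρ hρ hne
  have hpos : ‖dρ X ρ‖ ≠ 0 := norm_ne_zero_iff.2 hne
  -- Pointwise, n ∂_ρ s = (-∂_ρ y, ∂_ρ x), which matches the integrand of the area derivative.
  rw [hρ, normal, ds, arcDensity, perp_smul, ← smul_neg, real_inner_smul_left]
  simp only [RCLike.inner_apply, conj_trivial, PiLp.inner_apply, Fin.sum_univ_two, perp,
    PiLp.neg_apply, one_mul]
  rw [mul_comm, mul_inv_cancel_left₀ hpos]
  simp
  ring

end Area

end SurfaceDiffusion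

/-! ### Conclusion -/

theorem mainTheorem9
    (γ k : SurfaceDiffusion.Plane → ℝ)
    (hγ : ContDiffOn ℝ 1 (SurfaceDiffusion.homExt γ) {0}ᶜ)
    (hk : ∀ n : SurfaceDiffusion.Plane, ‖n‖ = 1 → 0 ≤ k n)
    (X : ℝ → SurfaceDiffusion.H1 SurfaceDiffusion.Plane)
    (μ : ℝ → SurfaceDiffusion.H1 ℝ)
    (hsol : SurfaceDiffusion.IsWeakSolution γ k X μ) :
    (∀ t : ℝ, 0 ≤ t → SurfaceDiffusion.area (X t) = SurfaceDiffusion.area (X 0)) ∧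
    (∀ t₁ t : ℝ, 0 ≤ t₁ → t₁ ≤ t →
      SurfaceDiffusion.energy γ (X t) ≤ SurfaceDiffusion.energy γ (X t₁) ∧
      SurfaceDiffusion.energy γ (X t₁) ≤ SurfaceDiffusion.energy γ (X 0)) := by
  open SurfaceDiffusion MeasureTheory in
  obtain ⟨C, hC1, hC⟩ := hsol.regular
  obtain ⟨V, hV, heq⟩ := hsol.equations
  have hne : ∀ t : ℝ, 0 ≤ t → ∀ᵐ ρ ∂torusMeasure, dρ (X t) ρ ≠ 0 := by
    intro t ht
    filter_upwards [hC t ht] with ρ hρ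
    exact norm_pos_iff.1 (lt_of_lt_of_le (by positivity) hρ.1)
  have heq' : ∀ᵐ t ∂(volume.restrict (Set.Ioi (0 : ℝ))),
      WeakEquations γ k (X t) (V t) (μ t) ∧ ∀ᵐ ρ ∂torusMeasure, dρ (X t) ρ ≠ 0 := by
    filter_upwards [heq, ae_restrict_mem measurableSet_Ioi] with t h ht
    exact ⟨h, hne t (le_of_lt ht)⟩
  obtain ⟨L, hL⟩ := exists_lipschitzWith_energy hγ
  have henergy : ∀ a b : ℝ, 0 ≤ a → a ≤ b → energy γ (X b) ≤ energy γ (X a) := fun a b ha hab =>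
    hV.functional_le hL.locallyLipschitz hsol.continuousOn
      (heq'.mono fun t ht => ⟨_, neg_nonpos.2 (curveInner_self_nonneg _ _),
        ht.1.hasLineDerivAt_energy hγ ht.2⟩) ha hab
  refine ⟨fun t ht => le_antisymm ?_ ?_, fun t₁ t h1 h2 =>
    ⟨henergy t₁ t h1 h2, henergy 0 t₁ le_rfl h1⟩⟩
  · exact hV.functional_le contDiff_area.locallyLipschitz hsol.continuousOn
      (heq'.mono fun t ht => ⟨0, le_rfl, ht.1.hasLineDerivAt_area ht.2⟩) le_rfl ht
  -- The area derivative is exactly 0, so monotonicity also applies to `-area` and gives the reverse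
  -- inequality.
  · refine neg_le_neg_iff.1 (hV.functional_le (F := fun u => -area u)
      contDiff_area.neg.locallyLipschitz hsol.continuousOn
      (heq'.mono fun t ht => ⟨0, le_rfl, ?_⟩) le_rfl ht)
    have := (ht.1.hasLineDerivAt_area ht.2 : HasDerivAt _ _ _).neg
    rwa [neg_zero] at this
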